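/- All tensors are over $\mathbb{C}$; write $[T_{i,j,k}]$ for the coordinates of $T\in\mathbb{C}^a\otimes\mathbb{C}^b\otimes\mathbb{C}^c$. A tensor $T\in\mathbb{C}^a\otimes\mathbb{C}^b\otimes\mathbb{C}^c$ restricts to $T'\in\mathbb{C}^{a'}\otimes\mathbb{C}^{b'}\otimes\mathbb{C}^{c'}$ if $T'=(A\otimes B\otimes C)T$ for some matrices $A\in\mathbb{C}^{a'\times a}$, $B\in\mathbb{C}^{b'\times b}$, $C\in\mathbb{C}^{c'\times c}$; $T$ and $T'$ are equivalent if each restricts to the other. $T$ degenerates to $T'$, written $T\trianglerighteq T'$ (and $T'$ is then called a degeneration of $T$), if the Euclidean closure of the orbit $(\mathrm{GL}_a\times\mathrm{GL}_b\times\mathrm{GL}_c)\cdot T$ contains a tensor equivalent to $T'$. $T$ is concise if it is not equivalent to any tensor in $\mathbb{C}^{a'}\otimes\mathbb{C}^{b'}\otimes\mathbb{C}^{c'}$ with $a'<a$ or $b'<b$ or $c'<c$. For $T\neq 0$, the minrank of $T$ is $$\operatorname{minrank}(T)=\min\Bigl(\Bigl\{\operatorname{rank}\Bigl[\sum_{i=1}^a\beta_iT_{i,j,k}\Bigr]_{j,k}\;\Big|\;\beta\in\mathbb{C}^a\Bigr\}\setminus\{0\}\Bigr).$$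 For $n\in\mathbb{N}$, the matrix multiplication tensor is $$\mathsf{M}_n=\sum_{i,j,k=1}^n e_{i,j}\otimes e_{j,k}\otimes e_{k,i}\in\mathbb{C}^{n^2}\otimes\mathbb{C}^{n^2}\otimes\mathbb{C}^{n^2},$$ where $e_{i,j}$ is the $n\times n$ matrix with a single nonzero entry $1$ at position $(i,j)$, flattened along the rows to a vector in $\mathbb{C}^{n^2}$. Lemma. Let $T\in\mathbb{C}^a\otimes\mathbb{C}^b\otimes\mathbb{C}^c$ be a nonzero concise tensor. If $\mathsf{M}_n\trianglerighteq T$, then $$\operatorname{minrank}(T)\leq n\bigl(n-\lfloor\sqrt{a-1}\rfloor\bigr).$$ -/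

import Mathlib

/-- Tensors in `ℂ^a ⊗ ℂ^b ⊗ ℂ^c`, given by their coordinates `T i j k` in the standard basis. As a
topological space this carries the Euclidean topology. -/
abbrev Tensor3 (a b c : ℕ) : Type := Fin a → Fin b → Fin c → ℂ

namespace Tensor3

/-- The simple tensor `u ⊗ v ⊗ w`. -/
def simple {a b c : ℕ} (u : Fin a → ℂ) (v : Fin b → ℂ) (w : Fin c → ℂ) : Tensor3 a b c :=
  fun i j k => u i * v j * w k

/-- The tensor `(A ⊗ B ⊗ C) T`. -/
def act {a b c a' b' c' : ℕ} (A : Matrix (Fin a') (Fin a) ℂ) (B : Matrix (Fin b') (Fin b) ℂ)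
    (C : Matrix (Fin c') (Fin c) ℂ) (T : Tensor3 a b c) : Tensor3 a' b' c' :=
  fun i' j' k' => ∑ i, ∑ j, ∑ k, A i' i * B j' j * C k' k * T i j k

/-- `T` restricts to `T'`, that is, `T ≥ T'`. -/
def RestrictsTo {a b c a' b' c' : ℕ} (T : Tensor3 a b c) (T' : Tensor3 a' b' c') : Prop :=
  ∃ (A : Matrix (Fin a') (Fin a) ℂ) (B : Matrix (Fin b') (Fin b) ℂ)
    (C : Matrix (Fin c') (Fin c) ℂ), act A B C T = T'

/-- Equivalence of tensors: each restricts to the other. -/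
def Equivalent {a b c a' b' c' : ℕ} (T : Tensor3 a b c) (T' : Tensor3 a' b' c') : Prop :=
  RestrictsTo T T' ∧ RestrictsTo T' T

/-- The orbit of `T` under `GL_a × GL_b × GL_c`. -/
def orbit {a b c : ℕ} (T : Tensor3 a b c) : Set (Tensor3 a b c) :=
  {S | ∃ (A : GL (Fin a) ℂ) (B : GL (Fin b) ℂ) (C : GL (Fin c) ℂ),
    S = act (A : Matrix (Fin a) (Fin a) ℂ) (B : Matrix (Fin b) (Fin b) ℂ)
      (C : Matrix (Fin c) (Fin c) ℂ) T}

/-- `T` degenerates to `T'`: the closure of the orbit of `T` contains a tensor equivalent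
to `T'`. -/
def DegeneratesTo {a b c a' b' c' : ℕ} (T : Tensor3 a b c) (T' : Tensor3 a' b' c') : Prop :=
  ∃ S ∈ closure (orbit T), Equivalent S T'

/-- `T` is concise: it is not equivalent to a tensor of a format that is smaller in one of the
three directions. -/
def Concise {a b c : ℕ} (T : Tensor3 a b c) : Prop :=
  ¬ ∃ (a' b' c' : ℕ) (T' : Tensor3 a' b' c'),
    (a' < a ∨ b' < b ∨ c' < c) ∧ Equivalent T T'

/-- The linear combination `(β ⊗ I_b ⊗ I_c) T` of the slices of `T` in the first direction, as a
`b × c` matrix. -/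
def sliceComb {a b c : ℕ} (β : Fin a → ℂ) (T : Tensor3 a b c) : Matrix (Fin b) (Fin c) ℂ :=
  Matrix.of fun j k => ∑ i, β i * T i j k

/-- The minrank of a (nonzero) tensor: the smallest nonzero rank of a linear combination of its
slices in the first direction. For `T ≠ 0` this is a minimum over a nonempty set of naturals. -/
noncomputable def minrank {a b c : ℕ} (T : Tensor3 a b c) : ℕ :=
  sInf (Set.range (fun β : Fin a → ℂ => (sliceComb β T).rank) \ {0})

/-- The standard basis matrix `e_{i,j}` of size `m × n`, flattened along the rows to a vector of
length `m * n`. -/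
def flatUnit {m n : ℕ} (i : Fin m) (j : Fin n) : Fin (m * n) → ℂ :=
  Pi.single (finProdFinEquiv (i, j)) 1

/-- The matrix multiplication tensor
`∑ i j k, e_{i,j} ⊗ e_{j,k} ⊗ e_{k,i}` of format `n₁n₂ × n₂n₃ × n₃n₁`. -/
def matMul (n₁ n₂ n₃ : ℕ) : Tensor3 (n₁ * n₂) (n₂ * n₃) (n₃ * n₁) :=
  ∑ i : Fin n₁, ∑ j : Fin n₂, ∑ k : Fin n₃, simple (flatUnit i j) (flatUnit j k) (flatUnit k i)

end Tensor3

/-! A slice combination of `matMul n n n` is, up to reindexing, `Xᵀ ⊗ I_n` for an `n × n` matrix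
`X`, so its rank is at most `n * rank X`. For a restriction with `a` slices, `X` runs through a
linear space; unless some nonzero combination vanishes, that space has dimension `a > r ^ 2` with `r
= ⌊√(a-1)⌋`. Matrices of rank at most `n - r` form a cone of dimension `n ^ 2 - r ^ 2`, so the space
contains a nonzero one (`exists_rank_le_of_sq_lt_finrank`). A degeneration is a limit of
restrictions; with coefficient vectors on the unit sphere, compactness and closedness of rank bounds
carry the estimate to `T`. Conciseness makes the limiting combination nonzero.

The dimension count uses the parametrization `(Y, Z) ↦ Y * Z` through dimension `m = n - r`. If
linear forms cut the cone only at the origin, the Nullstellensatz makes its coordinates integral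
over these forms, so there are at least as many forms as algebraically independent coordinates. The
`n ^ 2 - r ^ 2` entries in the first `m` rows or columns are independent, while only `n ^ 2 - dim L`
forms define `L`. -/

/-! ### Graded polynomial algebra -/

namespace MvPolynomial

variable {ι σ : Type*}

/-- The linear form `f` on `ι → ℂ`, as a polynomial. -/
noncomputable def ofLinearForm [Fintype ι] [DecidableEq ι] (f : (ι → ℂ) →ₗ[ℂ] ℂ) :
    MvPolynomial ι ℂ :=
  ∑ i, C (f (Pi.single i 1)) * X i

theorem isHomogeneous_ofLinearForm [Fintype ι] [DecidableEq ι] (f : (ι → ℂ) →ₗ[ℂ] ℂ) :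
    (ofLinearForm f).IsHomogeneous 1 :=
  IsHomogeneous.sum _ _ _ fun i _ => isHomogeneous_C_mul_X _ i

theorem aeval_ofLinearForm [Fintype ι] [DecidableEq ι] (f : (ι → ℂ) →ₗ[ℂ] ℂ) (x : ι → ℂ) :
    aeval x (ofLinearForm f) = f x := by
  simp only [ofLinearForm, map_sum, map_mul, aeval_X, algHom_C, Algebra.algebraMap_self,
    RingHom.id_apply]
  conv_rhs => rw [← Finset.univ_sum_single x, map_sum]
  refine Finset.sum_congr rfl fun i _ => ?_
  have : (Pi.single i (x i) : ι → ℂ) = x i • Pi.single i 1 := by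
    rw [← Pi.single_smul]; simp
  rw [this, map_smul, smul_eq_mul, mul_comm]

theorem homogeneousComponent_mul_of_isHomogeneous {R : Type*} [CommRing R]
    {l : MvPolynomial ι R} {m : ℕ} (hl : l.IsHomogeneous m) (g : MvPolynomial ι R) (e : ℕ) :
    homogeneousComponent (m + e) (l * g) = l * homogeneousComponent e g := by
  have key : ∀ j, homogeneousComponent (m + e) (l * homogeneousComponent j g) =
      if j = e then l * homogeneousComponent e g else 0 := by
    intro j
    rw [homogeneousComponent_of_mem (hl.mul (homogeneousComponent_isHomogeneous j g))]
    by_cases h : j = e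
    · simp [h]
    · rw [if_neg (by omega), if_neg h]
  conv_lhs => rw [← sum_homogeneousComponent g, Finset.mul_sum, map_sum]
  simp only [key, Finset.sum_ite_eq', Finset.mem_range]
  split_ifs with h
  · rfl
  · rw [homogeneousComponent_eq_zero _ _ (by omega), mul_zero]

theorem homogeneousComponent_aeval {R : Type*} [CommRing R] {u : ι → MvPolynomial σ R} {d : ℕ}
    (hd : d ≠ 0) (hu : ∀ i, (u i).IsHomogeneous d) (g : MvPolynomial ι R) (e : ℕ) :
    homogeneousComponent (d * e) (aeval u g) = aeval u (homogeneousComponent e g) := by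
  have key : ∀ j, homogeneousComponent (d * e) (aeval u (homogeneousComponent j g)) =
      if j = e then aeval u (homogeneousComponent e g) else 0 := by
    intro j
    rw [homogeneousComponent_of_mem ((homogeneousComponent_isHomogeneous j g).aeval u hu)]
    by_cases h : j = e
    · simp [h]
    · rw [if_neg (fun h' => h (Nat.eq_of_mul_eq_mul_left (Nat.pos_of_ne_zero hd) h'.symm)),
        if_neg h]
  conv_lhs => rw [← sum_homogeneousComponent g, map_sum, map_sum]
  simp only [key, Finset.sum_ite_eq', Finset.mem_range]
  split_ifs with h
  · rfl
  · rw [homogeneousComponent_eq_zero _ _ (by omega), map_zero]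

theorem IsHomogeneous.mem_span_X_pow {R : Type*} [CommRing R] {p : MvPolynomial ι R} {e : ℕ}
    (hp : p.IsHomogeneous e) : p ∈ Ideal.span (Set.range (X : ι → MvPolynomial ι R)) ^ e := by
  rw [Ideal.mem_span_pow_iff_exists_isHomogeneous]
  refine ⟨map C p, hp.map _, ?_⟩
  rw [eval_map]
  exact eval₂_eta p

/-! ### Linear sections of parametrized cones -/

section Projective

variable {k : ℕ} {u : ι → MvPolynomial σ ℂ} {l : Fin k → MvPolynomial ι ℂ}

/-- If the polynomials `l s` have no common zero but the origin on the variety parametrized by `u`,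
then all homogeneous polynomials of large degree are in the ideal of the `l s`, modulo the
relations of `u`. -/
theorem exists_pow_le_of_zeroLocus [Finite ι]
    (h : ∀ x : ι → ℂ, (∀ p : MvPolynomial ι ℂ, aeval u p = 0 → aeval x p = 0) → (∀ s, aeval x (l s) = 0) → x = 0) :
    ∃ D : ℕ, Ideal.span (Set.range (X : ι → MvPolynomial ι ℂ)) ^ D ≤
      RingHom.ker (aeval u : MvPolynomial ι ℂ →ₐ[ℂ] MvPolynomial σ ℂ) ⊔
        Ideal.span (Set.range l) := by
  apply Ideal.exists_pow_le_of_le_radical_of_fg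
  · rw [← vanishingIdeal_zeroLocus_eq_radical (K := ℂ), Ideal.span_le]
    rintro _ ⟨i, rfl⟩ x hx
    have hx0 : x = 0 := h x
      (fun p hp => hx p (Ideal.mem_sup_left hp))
      (fun s => hx _ (Ideal.mem_sup_right (Ideal.subset_span ⟨s, rfl⟩)))
    simp [hx0]
  · exact Submodule.fg_span (Set.finite_range _)

/-- Relations of `u` die under `aeval u`; since `u` has constant degree `d`, the coefficients of the
`l s` can be cut down to their degree `e` parts. -/
theorem exists_aeval_eq_sum_of_isHomogeneous {d : ℕ} (hd : d ≠ 0) (hu : ∀ i, (u i).IsHomogeneous d)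
    (hl : ∀ s, (l s).IsHomogeneous 1) {p : MvPolynomial ι ℂ} {e : ℕ}
    (hp : p.IsHomogeneous (1 + e))
    (hmem : p ∈ RingHom.ker (aeval u : MvPolynomial ι ℂ →ₐ[ℂ] MvPolynomial σ ℂ) ⊔
      Ideal.span (Set.range l)) :
    ∃ g : Fin k → MvPolynomial ι ℂ, (∀ s, (g s).IsHomogeneous e) ∧
      aeval u p = ∑ s, aeval u (l s) * aeval u (g s) := by
  obtain ⟨f, hf, q, hq, rfl⟩ := Submodule.mem_sup.mp hmem
  obtain ⟨c, rfl⟩ := (Submodule.mem_span_range_iff_exists_fun _).mp hq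
  refine ⟨fun s => homogeneousComponent e (c s), fun s => homogeneousComponent_isHomogeneous _ _, ?_⟩
  rw [← homogeneousComponent_eq_self hp, map_add, map_add, ← homogeneousComponent_aeval hd hu,
    (RingHom.mem_ker).mp hf, map_zero, zero_add, map_sum, map_sum]
  refine Finset.sum_congr rfl fun s _ => ?_
  rw [smul_eq_mul, mul_comm, homogeneousComponent_mul_of_isHomogeneous (hl s), map_mul]

/-- Graded Noether normalization: the image of `aeval u` lies in a finite module over the algebra of
the forms, and each `u i` multiplies that module into itself. -/
theorem isIntegral_of_zeroLocus [Finite ι] {d : ℕ} (hd : d ≠ 0) (hu : ∀ i, (u i).IsHomogeneous d)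
    (hl : ∀ s, (l s).IsHomogeneous 1)
    (h : ∀ x : ι → ℂ, (∀ p : MvPolynomial ι ℂ, aeval u p = 0 → aeval x p = 0) → (∀ s, aeval x (l s) = 0) → x = 0)
    (i : ι) :
    IsIntegral (Algebra.adjoin ℂ (Set.range fun s => aeval u (l s))) (u i) := by
  obtain ⟨D, hD⟩ := exists_pow_le_of_zeroLocus h
  set B := Algebra.adjoin ℂ (Set.range fun s => aeval u (l s)) with hB
  let S : Set (ι →₀ ℕ) := {m | m.degree ≤ D}
  have hS : S.Finite := Finsupp.finite_of_degree_le D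
  let M : Submodule B (MvPolynomial σ ℂ) :=
    Submodule.span B ((fun m => aeval u (monomial m (1 : ℂ))) '' S)
  -- Up to degree `D` the generators suffice; above it, a form can be split off each term, lowering
  -- the degree by one.
  have hM : ∀ e (p : MvPolynomial ι ℂ), p.IsHomogeneous e → aeval u p ∈ M := by
    intro e
    induction e with
    | zero =>
      intro p hp
      rw [← homogeneousComponent_eq_self hp, homogeneousComponent_zero]
      have h1 : (1 : MvPolynomial σ ℂ) ∈ M :=
        Submodule.subset_span ⟨0, by simp [S], by simp⟩
      have := M.smul_mem (algebraMap ℂ B (coeff 0 p)) h1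
      rw [algebraMap_smul, Algebra.smul_def, mul_one] at this
      rwa [algHom_C]
    | succ e ih =>
      intro p hp
      rcases le_or_gt (e + 1) D with he | he
      · rw [p.as_sum, map_sum]
        refine Submodule.sum_mem _ fun m hm => ?_
        have hdeg : m.degree = e + 1 := by
          have := hp (mem_support_iff.mp hm)
          rwa [Finsupp.degree_eq_weight_one]
        have h1 : aeval u (monomial m (1 : ℂ)) ∈ M :=
          Submodule.subset_span ⟨m, by simp only [S, Set.mem_ofPred_eq]; omega, rfl⟩
        have := M.smul_mem (algebraMap ℂ B (coeff m p)) h1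
        rwa [algebraMap_smul, ← map_smul, smul_monomial, smul_eq_mul, mul_one] at this
      · have hp' : p.IsHomogeneous (1 + e) := by rwa [add_comm]
        obtain ⟨g, hg, hpg⟩ := exists_aeval_eq_sum_of_isHomogeneous hd hu hl hp'
          (hD (Ideal.pow_le_pow_right he.le hp.mem_span_X_pow))
        rw [hpg]
        refine Submodule.sum_mem _ fun s _ => ?_
        exact M.smul_mem (⟨_, Algebra.subset_adjoin ⟨s, rfl⟩⟩ : B) (ih (g s) (hg s))
  refine isIntegral_of_smul_mem_submodule M ?_ (Submodule.fg_span (hS.image _)) (u i) ?_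
  · have h1 : (1 : MvPolynomial σ ℂ) ∈ M := Submodule.subset_span ⟨0, by simp [S], by simp⟩
    intro h0
    rw [h0, Submodule.mem_bot] at h1
    exact one_ne_zero h1
  · intro n hn
    induction hn using Submodule.span_induction with
    | mem x hx =>
      obtain ⟨m, -, rfl⟩ := hx
      have := hM _ _ ((isHomogeneous_X ℂ i).mul (isHomogeneous_monomial (1 : ℂ) (n := m.degree) rfl))
      simpa using this
    | zero => simp
    | add x y _ _ hx hy => rw [smul_add]; exact M.add_mem hx hy
    | smul b x _ hx => rw [smul_comm]; exact M.smul_mem b hx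

/-- A variety parametrized by homogeneous polynomials of the same degree meets `k` hyperplanes
outside the origin if more than `k` of its coordinates are algebraically independent. -/
theorem ncard_le_of_zeroLocus [Finite ι] {d : ℕ} (hd : d ≠ 0) (hu : ∀ i, (u i).IsHomogeneous d)
    (hl : ∀ s, (l s).IsHomogeneous 1)
    (h : ∀ x : ι → ℂ, (∀ p : MvPolynomial ι ℂ, aeval u p = 0 → aeval x p = 0) → (∀ s, aeval x (l s) = 0) → x = 0)
    {t : Set ι} (ht : AlgebraicIndependent ℂ fun i : t => u i) : t.ncard ≤ k := by
  set v : Fin k → MvPolynomial σ ℂ := fun s => aeval u (l s)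
  have hsub : Set.range (fun i : t => u i) ⊆
      (AlgebraicIndependent.matroid ℂ (MvPolynomial σ ℂ)).closure (Set.range v) := by
    rw [AlgebraicIndependent.matroid_closure_eq]
    rintro _ ⟨i, rfl⟩
    exact (isIntegral_of_zeroLocus hd hu hl h i).isAlgebraic
  have hind : (AlgebraicIndependent.matroid ℂ (MvPolynomial σ ℂ)).Indep
      (Set.range fun i : t => u i) :=
    AlgebraicIndependent.matroid_indep_iff.mpr ht.coe_range
  -- Rank in the algebraic independence matroid is transcendence degree: an independent set in the
  -- closure of `k` elements has at most `k` members.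
  have h1 := hind.encard_le_eRk_of_subset hsub
  rw [Matroid.eRk_closure_eq] at h1
  have h2 := h1.trans (Matroid.eRk_le_encard _ _)
  have h3 : (Set.range v).encard ≤ k := by
    rw [← Set.image_univ]
    refine (Set.encard_image_le _ _).trans ?_
    simp
  have h4 : (Set.range fun i : t => u i).encard = t.encard := by
    rw [← Set.image_univ, ht.injective.encard_image, Set.encard_univ]
    rfl
  rw [h4, ← t.toFinite.cast_ncard_eq] at h2
  exact_mod_cast h2.trans h3

end Projective

end MvPolynomial

/-! ### Rank and determinants of compressions -/

namespace Matrix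

theorem exists_det_ne_zero_of_le_rank {K : Type*} [Field K] {p q s : ℕ}
    (x : Matrix (Fin p) (Fin q) K) (h : s ≤ x.rank) :
    ∃ (P : Matrix (Fin s) (Fin p) K) (Q : Matrix (Fin q) (Fin s) K), (P * x * Q).det ≠ 0 := by
  obtain ⟨v, hv⟩ := exists_linearIndependent_of_le_finrank (R := K)
    (M := LinearMap.range x.mulVecLin) h
  choose w hw using fun i => (v i).2
  have hv' : LinearIndependent K fun i => (v i : Fin p → K) :=
    hv.map' (Submodule.subtype _) (Submodule.ker_subtype _)
  let Q : Matrix (Fin q) (Fin s) K := Matrix.of fun j i => w i j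
  have hcol : (x * Q).col = fun i => (v i : Fin p → K) := by
    funext i j
    have := congrFun (hw i) j
    simpa [Q, Matrix.mul_apply, Matrix.mulVec, dotProduct] using this
  have hinj : Function.Injective (x * Q).mulVec := by
    rw [Matrix.mulVec_injective_iff, hcol]
    exact hv'
  obtain ⟨g, hg⟩ := LinearMap.exists_leftInverse_of_injective (Matrix.toLin' (x * Q))
    (LinearMap.ker_eq_bot.mpr hinj)
  refine ⟨LinearMap.toMatrix' g, Q, ?_⟩
  have : LinearMap.toMatrix' g * x * Q = 1 := by
    rw [Matrix.mul_assoc, ← LinearMap.toMatrix'_id, ← hg, LinearMap.toMatrix'_comp,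
      LinearMap.toMatrix'_toLin']
  rw [this, Matrix.det_one]
  exact one_ne_zero

theorem le_rank_of_det_ne_zero {K : Type*} [Field K] {p q s : ℕ}
    (x : Matrix (Fin p) (Fin q) K) (P : Matrix (Fin s) (Fin p) K) (Q : Matrix (Fin q) (Fin s) K)
    (h : (P * x * Q).det ≠ 0) : s ≤ x.rank := by
  have h1 := Matrix.rank_of_det_ne_zero h
  rw [Fintype.card_fin] at h1
  have h2 := Matrix.rank_mul_le_left (P * x) Q
  have h3 := Matrix.rank_mul_le_right P x
  omega

/-- Rank at most `s` is the vanishing of all determinants of `(s + 1) × (s + 1)` compressions, each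
continuous in `x`. -/
theorem isClosed_setOf_rank_le (p q s : ℕ) :
    IsClosed {x : Matrix (Fin p) (Fin q) ℂ | x.rank ≤ s} := by
  have : {x : Matrix (Fin p) (Fin q) ℂ | x.rank ≤ s} =
      ⋂ (P : Matrix (Fin (s + 1)) (Fin p) ℂ) (Q : Matrix (Fin q) (Fin (s + 1)) ℂ),
        {x | (P * x * Q).det = 0} := by
    ext x
    simp only [Set.mem_ofPred_eq, Set.mem_iInter]
    constructor
    · intro hx P Q
      by_contra hne
      have := le_rank_of_det_ne_zero x P Q hne
      omega
    · intro hx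
      by_contra hlt
      obtain ⟨P, Q, hPQ⟩ := exists_det_ne_zero_of_le_rank x (s := s + 1) (by omega)
      exact hPQ (hx P Q)
  rw [this]
  refine isClosed_iInter fun P => isClosed_iInter fun Q => isClosed_eq ?_ continuous_const
  fun_prop

/-- A product of matrices through a smaller dimension has zero determinant. -/
theorem det_mul_eq_zero_of_lt {R : Type*} [CommRing R] [IsDomain R] {s m : ℕ} (h : m < s)
    (P : Matrix (Fin s) (Fin m) R) (Q : Matrix (Fin m) (Fin s) R) : (P * Q).det = 0 := by
  by_contra hne
  have h1 := Matrix.rank_of_det_ne_zero hne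
  have h2 := Matrix.rank_mul_le_left P Q
  have h3 := Matrix.rank_le_width P
  rw [Fintype.card_fin] at h1
  omega

end Matrix

/-! ### The determinantal cone and its dimension -/

section GenericProduct

open MvPolynomial

/-- The entries of the product of a generic `n × m` matrix with a generic `m × n` matrix. -/
noncomputable def genericProduct (n m : ℕ) (ij : Fin n × Fin n) :
    MvPolynomial (Fin n × Fin m ⊕ Fin m × Fin n) ℂ :=
  ∑ s, X (Sum.inl (ij.1, s)) * X (Sum.inr (s, ij.2))

theorem isHomogeneous_genericProduct (n m : ℕ) (ij : Fin n × Fin n) :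
    (genericProduct n m ij).IsHomogeneous 2 :=
  IsHomogeneous.sum _ _ _ fun _ _ => (isHomogeneous_X ℂ _).mul (isHomogeneous_X ℂ _)

theorem aeval_genericProduct {n m : ℕ} (Y : Matrix (Fin n) (Fin m) ℂ)
    (Z : Matrix (Fin m) (Fin n) ℂ) (ij : Fin n × Fin n) :
    aeval (Sum.elim (fun p => Y p.1 p.2) fun p => Z p.1 p.2) (genericProduct n m ij) =
      (Y * Z) ij.1 ij.2 := by
  simp [genericProduct, Matrix.mul_apply]

/-- The determinants of `(m + 1) × (m + 1)` compressions are relations, because the generic product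
factors through dimension `m`. -/
theorem rank_le_of_relations {n m : ℕ} (x : Fin n × Fin n → ℂ)
    (h : ∀ p : MvPolynomial (Fin n × Fin n) ℂ, aeval (genericProduct n m) p = 0 → aeval x p = 0) :
    (Matrix.of fun i j => x (i, j)).rank ≤ m := by
  by_contra hlt
  obtain ⟨P, Q, hPQ⟩ := Matrix.exists_det_ne_zero_of_le_rank (Matrix.of fun i j => x (i, j))
    (s := m + 1) (by omega)
  let G : Matrix (Fin n) (Fin n) (MvPolynomial (Fin n × Fin n) ℂ) := Matrix.of fun i j => X (i, j)
  let P' : Matrix (Fin (m + 1)) (Fin n) (MvPolynomial (Fin n × Fin n) ℂ) := P.map C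
  let Q' : Matrix (Fin n) (Fin (m + 1)) (MvPolynomial (Fin n × Fin n) ℂ) := Q.map C
  have hmap : ∀ {R : Type} [CommRing R] [Algebra ℂ R] (y : Fin n × Fin n → R),
      aeval y (P' * G * Q').det =
        (P.map (algebraMap ℂ R) * (Matrix.of fun i j => y (i, j)) * Q.map (algebraMap ℂ R)).det := by
    intro R _ _ y
    rw [AlgHom.map_det]
    congr 1
    ext i j
    simp [Matrix.mul_apply, G, P', Q']
  refine hPQ ?_
  have := h (P' * G * Q').det ?_
  · rw [hmap] at this
    exact this
  · rw [hmap]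
    let Y : Matrix (Fin n) (Fin m) (MvPolynomial (Fin n × Fin m ⊕ Fin m × Fin n) ℂ) :=
      Matrix.of fun i s => X (Sum.inl (i, s))
    let Z : Matrix (Fin m) (Fin n) (MvPolynomial (Fin n × Fin m ⊕ Fin m × Fin n) ℂ) :=
      Matrix.of fun s j => X (Sum.inr (s, j))
    have hfac : (Matrix.of fun i j => genericProduct n m (i, j)) = Y * Z := by
      ext1 i j
      simp [genericProduct, Matrix.mul_apply, Y, Z]
    rw [hfac, ← Matrix.mul_assoc, Matrix.mul_assoc]
    exact Matrix.det_mul_eq_zero_of_lt (Nat.lt_succ_self m) _ _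

/-- The positions in the first `m` rows or the first `m` columns. -/
def hookPositions (n m : ℕ) : Set (Fin n × Fin n) :=
  {p | p.1.val < m ∨ p.2.val < m}

theorem ncard_hookPositions {n m : ℕ} (hm : m ≤ n) :
    (hookPositions n m).ncard + (n - m) ^ 2 = n ^ 2 := by
  have h1 := Set.ncard_add_ncard_compl (hookPositions n m)
  have h2 : (hookPositions n m)ᶜ = ({i : Fin n | m ≤ i.val} ×ˢ {i : Fin n | m ≤ i.val}) := by
    ext ⟨i, j⟩
    simp [hookPositions]
  have h3 : ({i : Fin n | m ≤ i.val}).ncard = n - m := by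
    have : {i : Fin n | m ≤ i.val} = ((Finset.univ.filter fun i : Fin n => m ≤ i.val) : Finset _) := by
      ext; simp
    rw [this, Set.ncard_coe_finset]
    have h := Finset.card_filter_add_card_filter_not (s := (Finset.univ : Finset (Fin n)))
      (fun i => i.val < m)
    simp only [not_lt] at h
    rw [Fin.card_filter_val_lt, Finset.card_univ, Fintype.card_fin] at h
    omega
  rw [h2, Set.ncard_prod, h3, Nat.card_prod, Nat.card_fin] at h1
  rw [sq, sq, h1]

/-- A matrix whose leading `m × m` block is invertible can be changed outside the first `m` rows
and columns so that it factors through dimension `m`. -/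
theorem exists_factorization {n m : ℕ} (hm : m ≤ n) (x : Matrix (Fin n) (Fin n) ℂ)
    (hx : (x.submatrix (Fin.castLE hm) (Fin.castLE hm)).det ≠ 0) :
    ∃ (Y : Matrix (Fin n) (Fin m) ℂ) (Z : Matrix (Fin m) (Fin n) ℂ),
      ∀ p ∈ hookPositions n m, (Y * Z) p.1 p.2 = x p.1 p.2 := by
  set A := x.submatrix (Fin.castLE hm) (Fin.castLE hm) with hA
  have hu : IsUnit A.det := isUnit_iff_ne_zero.mpr hx
  refine ⟨x.submatrix id (Fin.castLE hm) * A⁻¹, x.submatrix (Fin.castLE hm) id, ?_⟩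
  rintro ⟨i, j⟩ (hi | hj)
  · have h1 : (x.submatrix id (Fin.castLE hm) * A⁻¹).submatrix (Fin.castLE hm) id = 1 := by
      rw [Matrix.submatrix_mul _ _ (Fin.castLE hm) id id Function.bijective_id]
      exact Matrix.mul_nonsing_inv A hu
    have h2 : ((x.submatrix id (Fin.castLE hm) * A⁻¹) *
        x.submatrix (Fin.castLE hm) id).submatrix (Fin.castLE hm) id =
          x.submatrix (Fin.castLE hm) id := by
      rw [Matrix.submatrix_mul _ _ (Fin.castLE hm) id id Function.bijective_id, h1, Matrix.one_mul]
      rfl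
    exact congrFun (congrFun h2 ⟨i, hi⟩) j
  · have h2 : ((x.submatrix id (Fin.castLE hm) * A⁻¹) *
        x.submatrix (Fin.castLE hm) id).submatrix id (Fin.castLE hm) =
          x.submatrix id (Fin.castLE hm) := by
      rw [Matrix.submatrix_mul _ _ id id (Fin.castLE hm) Function.bijective_id]
      exact (Matrix.mul_assoc _ _ _).trans
        ((congrArg _ (Matrix.nonsing_inv_mul A hu)).trans (Matrix.mul_one _))
    exact congrFun (congrFun h2 i) ⟨j, hj⟩

/-- Hook entries can be prescribed freely once the leading block is invertible, so a relation `f`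
vanishes wherever `lead.det` does not, and `f * lead.det = 0`. -/
theorem algebraicIndependent_genericProduct {n m : ℕ} (hm : m ≤ n) :
    AlgebraicIndependent ℂ fun p : hookPositions n m => genericProduct n m p := by
  rw [algebraicIndependent_iff]
  intro f hf
  let lead : Matrix (Fin m) (Fin m) (MvPolynomial (hookPositions n m) ℂ) :=
    Matrix.of fun i j => X ⟨(Fin.castLE hm i, Fin.castLE hm j), Or.inl i.2⟩
  have hlead : lead.det ≠ 0 := by
    intro h0
    have h1 := congrArg (aeval fun p : hookPositions n m => if p.1.1 = p.1.2 then (1 : ℂ) else 0) h0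
    rw [AlgHom.map_det, map_zero] at h1
    have h2 : (aeval fun p : hookPositions n m => if p.1.1 = p.1.2 then (1 : ℂ) else 0).mapMatrix
        lead = 1 := by
      ext i j
      simp [lead, Matrix.one_apply]
    rw [h2, Matrix.det_one] at h1
    exact one_ne_zero h1
  have hprod : f * lead.det = 0 := by
    refine MvPolynomial.funext fun y => ?_
    rw [map_mul, map_zero]
    by_cases hy : eval y lead.det = 0
    · rw [hy, mul_zero]
    · classical
      let x : Matrix (Fin n) (Fin n) ℂ := Matrix.of fun i j =>
        if h : (i, j) ∈ hookPositions n m then y ⟨(i, j), h⟩ else 0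
      have hx : (x.submatrix (Fin.castLE hm) (Fin.castLE hm)).det ≠ 0 := by
        rw [RingHom.map_det] at hy
        convert! hy using 2
        ext i j
        have : (Fin.castLE hm i, Fin.castLE hm j) ∈ hookPositions n m := Or.inl i.2
        simp [x, lead, this]
      obtain ⟨Y, Z, hYZ⟩ := exists_factorization hm x hx
      have h1 := congrArg (aeval (Sum.elim (fun p => Y p.1 p.2) fun p => Z p.1 p.2)) hf
      rw [map_zero, ← AlgHom.comp_apply, MvPolynomial.comp_aeval] at h1
      have h2 : (fun p : hookPositions n m =>
          aeval (Sum.elim (fun p => Y p.1 p.2) fun p => Z p.1 p.2)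
            (genericProduct n m p)) = y := by
        funext p
        rw [aeval_genericProduct, hYZ p p.2]
        simp [x]
      rw [h2, aeval_eq_eval] at h1
      rw [h1, zero_mul]
  exact (mul_eq_zero.mp hprod).resolve_right hlead

/-- A linear space of `n × n` matrices of dimension more than `r ^ 2` contains a nonzero matrix of
rank at most `n - r`. -/
theorem exists_rank_le_of_sq_lt_finrank {n r : ℕ} (hr : r ≤ n)
    (L : Submodule ℂ (Fin n × Fin n → ℂ)) (hL : r ^ 2 < Module.finrank ℂ L) :
    ∃ x ∈ L, x ≠ 0 ∧ (Matrix.of fun i j => x (i, j)).rank ≤ n - r := by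
  by_contra! hcon
  -- The coordinates of the quotient by `L` are `n ^ 2 - dim L` linear equations for `L`.
  let b := Module.finBasis ℂ ((Fin n × Fin n → ℂ) ⧸ L)
  let f := fun s => (b.coord s).comp L.mkQ
  have hle := ncard_le_of_zeroLocus (u := genericProduct n (n - r))
    (l := fun s => ofLinearForm (f s)) two_ne_zero
    (isHomogeneous_genericProduct n (n - r)) (fun s => isHomogeneous_ofLinearForm _)
    (fun x hx hl => by
      by_contra hne
      have hxL : x ∈ L := by
        rw [← Submodule.Quotient.mk_eq_zero]
        refine b.ext_elem fun s => ?_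
        have := hl s
        rw [aeval_ofLinearForm] at this
        simpa [f] using this
      have h1 := hcon x hxL hne
      have h2 := rank_le_of_relations x hx
      omega)
    (algebraicIndependent_genericProduct (Nat.sub_le n r))
  have h1 := ncard_hookPositions (Nat.sub_le n r)
  have h2 := L.finrank_quotient_add_finrank
  rw [Nat.sub_sub_self hr] at h1
  rw [Module.finrank_fintype_fun_eq_card, Fintype.card_prod, Fintype.card_fin] at h2
  nlinarith

end GenericProduct

/-! ### Rank factorization and Kronecker products -/

open scoped Kronecker

namespace Matrix

theorem exists_eq_mul_of_rank {K : Type*} [Field K] {p q : ℕ} (x : Matrix (Fin p) (Fin q) K) :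
    ∃ (P : Matrix (Fin p) (Fin x.rank) K) (Q : Matrix (Fin x.rank) (Fin q) K), x = P * Q := by
  let e : LinearMap.range (Matrix.toLin' x) ≃ₗ[K] (Fin x.rank → K) :=
    (Module.finBasis K (LinearMap.range (Matrix.toLin' x))).equivFun
  refine ⟨LinearMap.toMatrix' ((Submodule.subtype _).comp e.symm.toLinearMap),
    LinearMap.toMatrix' (e.toLinearMap.comp (Matrix.toLin' x).rangeRestrict), ?_⟩
  rw [← LinearMap.toMatrix'_comp]
  apply Matrix.toLin'.injective
  rw [Matrix.toLin'_toMatrix']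
  ext v
  simp

theorem eq_zero_of_rank_eq_zero {K : Type*} [Field K] {p q : ℕ} {x : Matrix (Fin p) (Fin q) K}
    (h : x.rank = 0) : x = 0 := by
  have h1 := LinearMap.range_eq_bot.mp (Submodule.finrank_eq_zero.mp h)
  ext i j
  simpa using congrFun (LinearMap.congr_fun h1 (Pi.single j 1)) i

theorem rank_kronecker_one_le {K : Type*} [Field K] {p q : ℕ} (r : ℕ)
    (x : Matrix (Fin p) (Fin q) K) :
    (x ⊗ₖ (1 : Matrix (Fin r) (Fin r) K)).rank ≤ x.rank * r := by
  obtain ⟨P, Q, hPQ⟩ := x.exists_eq_mul_of_rank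
  have : x ⊗ₖ (1 : Matrix (Fin r) (Fin r) K) =
      (P ⊗ₖ (1 : Matrix (Fin r) (Fin r) K)) * (Q ⊗ₖ (1 : Matrix (Fin r) (Fin r) K)) := by
    rw [← Matrix.mul_kronecker_mul, ← hPQ, Matrix.one_mul]
  rw [this]
  refine (Matrix.rank_mul_le_left _ _).trans ((Matrix.rank_le_card_width _).trans ?_)
  simp

end Matrix

/-! ### Slices, restrictions and degenerations -/

namespace Tensor3

variable {a b c : ℕ}

/-- The linear combination of slices, as a linear map in its coefficients. -/
noncomputable def sliceMap (T : Tensor3 a b c) : (Fin a → ℂ) →ₗ[ℂ] Matrix (Fin b) (Fin c) ℂ where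
  toFun β := sliceComb β T
  map_add' β γ := by
    ext j k
    simp [sliceComb, add_mul, Finset.sum_add_distrib]
  map_smul' z β := by
    ext j k
    simp [sliceComb, Finset.mul_sum, mul_assoc]

theorem sliceComb_act {a' b' c' : ℕ} (A : Matrix (Fin a') (Fin a) ℂ) (B : Matrix (Fin b') (Fin b) ℂ)
    (C : Matrix (Fin c') (Fin c) ℂ) (T : Tensor3 a b c) (β : Fin a' → ℂ) :
    sliceComb β (act A B C T) = B * sliceComb (A.vecMulLinear β) T * C.transpose := by
  ext j' k'
  simp only [sliceComb, act, Matrix.of_apply, Matrix.mul_apply, Matrix.transpose_apply,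
    Matrix.vecMulLinear_apply, Matrix.vecMul, dotProduct, Finset.mul_sum, Finset.sum_mul]
  conv_lhs => enter [2, i']; rw [Finset.sum_comm]
  conv_lhs => enter [2, i', 2, j]; rw [Finset.sum_comm]
  rw [Finset.sum_comm]
  conv_lhs => enter [2, j]; rw [Finset.sum_comm]
  rw [Finset.sum_comm]
  refine Finset.sum_congr rfl fun k _ => Finset.sum_congr rfl fun j _ => ?_
  rw [Finset.sum_comm]
  refine Finset.sum_congr rfl fun i _ => Finset.sum_congr rfl fun i' _ => ?_
  ring

theorem act_act {a' b' c' a'' b'' c'' : ℕ} (A : Matrix (Fin a') (Fin a) ℂ)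
    (B : Matrix (Fin b') (Fin b) ℂ) (C : Matrix (Fin c') (Fin c) ℂ)
    (A' : Matrix (Fin a'') (Fin a') ℂ) (B' : Matrix (Fin b'') (Fin b') ℂ)
    (C' : Matrix (Fin c'') (Fin c') ℂ) (T : Tensor3 a b c) :
    act A' B' C' (act A B C T) = act (A' * A) (B' * B) (C' * C) T := by
  have h : ∀ β, sliceComb β (act A' B' C' (act A B C T)) =
      sliceComb β (act (A' * A) (B' * B) (C' * C) T) := by
    intro β
    simp only [sliceComb_act, Matrix.vecMulLinear_apply, Matrix.vecMul_vecMul,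
      Matrix.transpose_mul, Matrix.mul_assoc]
  funext i j k
  have := congrFun (congrFun (h (Pi.single i 1)) j) k
  simpa [sliceComb, Pi.single_apply] using this

theorem matMul_apply (n₁ n₂ n₃ : ℕ) (i i' : Fin n₁) (j j' : Fin n₂) (k k' : Fin n₃) :
    matMul n₁ n₂ n₃ (finProdFinEquiv (i, j)) (finProdFinEquiv (j', k)) (finProdFinEquiv (k', i')) =
      if i = i' ∧ j = j' ∧ k = k' then 1 else 0 := by
  simp only [matMul, simple, flatUnit, Finset.sum_apply, Pi.single_apply,
    EmbeddingLike.apply_eq_iff_eq, Prod.mk.injEq]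
  rw [Finset.sum_eq_single i, Finset.sum_eq_single j, Finset.sum_eq_single k]
  · by_cases h1 : i' = i <;> by_cases h2 : j' = j <;> by_cases h3 : k' = k <;>
      simp [h1, h2, h3]
    all_goals grind
  all_goals
    intros
    simp_all [eq_comm]

theorem sliceComb_matMul (n : ℕ) (y : Fin (n * n) → ℂ) :
    sliceComb y (matMul n n n) =
      Matrix.reindex finProdFinEquiv ((Equiv.prodComm _ _).trans finProdFinEquiv)
        ((Matrix.of fun i j => y (finProdFinEquiv (i, j))).transpose ⊗ₖ
          (1 : Matrix (Fin n) (Fin n) ℂ)) := by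
  ext p q
  obtain ⟨⟨j, k⟩, rfl⟩ := finProdFinEquiv.surjective p
  obtain ⟨⟨k', i⟩, rfl⟩ := finProdFinEquiv.surjective q
  simp only [sliceComb, Matrix.of_apply]
  rw [← finProdFinEquiv.sum_comp, Fintype.sum_prod_type]
  simp only [matMul_apply]
  rw [Finset.sum_eq_single i, Finset.sum_eq_single j]
  · simp [Matrix.one_apply]
  all_goals
    intros
    simp_all

theorem rank_sliceComb_matMul_le (n : ℕ) (y : Fin (n * n) → ℂ) :
    (sliceComb y (matMul n n n)).rank ≤
      (Matrix.of fun i j => y (finProdFinEquiv (i, j))).rank * n := by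
  rw [sliceComb_matMul, Matrix.rank_reindex]
  refine (Matrix.rank_kronecker_one_le n _).trans_eq ?_
  rw [Matrix.rank_transpose]

/-- Every restriction of `matMul n n n` with more than `r ^ 2` slices has a normalized combination
of slices of rank at most `n * (n - r)`. -/
theorem exists_rank_sliceComb_act_le {n r : ℕ} (A : Matrix (Fin a) (Fin (n * n)) ℂ)
    (B : Matrix (Fin b) (Fin (n * n)) ℂ) (C : Matrix (Fin c) (Fin (n * n)) ℂ) (hr : r ^ 2 < a) :
    ∃ β : Fin a → ℂ, ‖β‖ = 1 ∧ (sliceComb β (act A B C (matMul n n n))).rank ≤ n * (n - r) := by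
  suffices ∃ β : Fin a → ℂ, β ≠ 0 ∧
      (sliceComb (A.vecMulLinear β) (matMul n n n)).rank ≤ n * (n - r) by
    obtain ⟨β, hβ, hrank⟩ := this
    -- Rescaling to norm one prepares the compactness argument; the scalar is absorbed into `B`.
    have hnorm : (‖β‖ : ℂ) ≠ 0 := by simpa using hβ
    refine ⟨(‖β‖ : ℂ)⁻¹ • β, by rw [norm_smul]; simp [hβ], ?_⟩
    have hs : sliceComb ((‖β‖ : ℂ)⁻¹ • β) (act A B C (matMul n n n)) =
        ((‖β‖ : ℂ)⁻¹ • B) * sliceComb (A.vecMulLinear β) (matMul n n n) * C.transpose := by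
      rw [Matrix.smul_mul, Matrix.smul_mul, ← sliceComb_act]
      exact (sliceMap _).map_smul _ _
    rw [hs]
    exact (Matrix.rank_mul_le_left _ _).trans ((Matrix.rank_mul_le_right _ _).trans hrank)
  by_cases hinj : Function.Injective A.vecMulLinear
  · have hle : a ≤ n * n := by
      have := LinearMap.finrank_le_finrank_of_injective hinj
      simpa using this
    have hrn : r ≤ n := by nlinarith
    let φ : (Fin a → ℂ) →ₗ[ℂ] (Fin n × Fin n → ℂ) :=
      (LinearMap.funLeft ℂ ℂ finProdFinEquiv).comp A.vecMulLinear
    have hφ : Function.Injective φ :=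
      (LinearMap.funLeft_injective_of_surjective ℂ ℂ _ finProdFinEquiv.surjective).comp hinj
    obtain ⟨_, ⟨β, rfl⟩, hne, hrank⟩ :=
      exists_rank_le_of_sq_lt_finrank hrn (LinearMap.range φ) (by
        rw [LinearMap.finrank_range_of_inj hφ]
        simpa using hr)
    refine ⟨β, fun h0 => hne (by rw [h0, map_zero]), ?_⟩
    refine (rank_sliceComb_matMul_le n _).trans ?_
    rw [mul_comm]
    exact Nat.mul_le_mul_left n hrank
  · rw [← LinearMap.ker_eq_bot, Submodule.eq_bot_iff] at hinj
    push Not at hinj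
    obtain ⟨β, hβ, hne⟩ := hinj
    refine ⟨β, hne, ?_⟩
    have h0 : sliceComb (A.vecMulLinear β) (matMul n n n) = 0 := by
      rw [LinearMap.mem_ker.mp hβ]
      exact (sliceMap _).map_zero
    rw [h0, Matrix.rank_zero]
    exact Nat.zero_le _

theorem act_one_one {a' : ℕ} (A : Matrix (Fin a') (Fin a) ℂ) (T : Tensor3 a b c) :
    act A 1 1 T = fun i' j k => ∑ i, A i' i * T i j k := by
  funext i' j k
  simp [act, Matrix.one_apply]

/-- The slices of a concise tensor are linearly independent. -/
theorem Concise.sliceComb_ne_zero {T : Tensor3 a b c} (hc : Concise T) {β : Fin a → ℂ}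
    (hβ : β ≠ 0) : sliceComb β T ≠ 0 := by
  intro h0
  obtain ⟨i₀, hi₀⟩ := Function.ne_iff.mp hβ
  obtain _ | a := a
  · exact i₀.elim0
  -- `D` deletes slice `i₀`; `E` recovers it from the others by solving the relation `β` for it.
  let D : Matrix (Fin a) (Fin (a + 1)) ℂ := Matrix.of fun i' i => if i = i₀.succAbove i' then 1 else 0
  let E : Matrix (Fin (a + 1)) (Fin a) ℂ := Matrix.of fun i i' =>
    i₀.insertNth (α := fun _ => ℂ) (-(β i₀)⁻¹ * β (i₀.succAbove i'))
      (fun l => if l = i' then 1 else 0) i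
  refine hc ⟨a, b, c, act D 1 1 T, Or.inl (Nat.lt_succ_self a), ⟨D, 1, 1, rfl⟩, E, 1, 1, ?_⟩
  rw [act_one_one, act_one_one]
  funext i j k
  simp only [D, E, Matrix.of_apply, ite_mul, one_mul, zero_mul, Finset.sum_ite_eq',
    Finset.mem_univ, if_true]
  refine i₀.succAboveCases ?_ (fun l => ?_) i
  · have h := congrFun (congrFun h0 j) k
    simp only [sliceComb, Matrix.of_apply, Matrix.zero_apply] at h
    rw [Fin.sum_univ_succAbove _ i₀] at h
    simp only [Fin.insertNth_apply_same, mul_assoc, ← Finset.mul_sum]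
    rw [eq_neg_of_add_eq_zero_right h]
    field_simp
    exact mul_div_cancel_left₀ _ hi₀
  · simp

/-- The restriction from `S` to `T` is a continuous map sending the orbit into restrictions of `M`,
hence closure into closure. -/
theorem mem_closure_of_degeneratesTo {a' b' c' : ℕ} {M : Tensor3 a b c} {T : Tensor3 a' b' c'}
    (h : DegeneratesTo M T) : T ∈ closure {T' | RestrictsTo M T'} := by
  obtain ⟨S, hS, ⟨A, B, C, rfl⟩, -⟩ := h
  have hcont : Continuous (act A B C) := by
    unfold act
    fun_prop
  refine map_mem_closure hcont hS ?_
  rintro _ ⟨A', B', C', rfl⟩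
  exact ⟨_, _, _, (act_act ..).symm⟩

theorem exists_rank_sliceComb_le_of_degeneratesTo {n r : ℕ} {T : Tensor3 a b c}
    (h : DegeneratesTo (matMul n n n) T) (hr : r ^ 2 < a) :
    ∃ β : Fin a → ℂ, β ≠ 0 ∧ (sliceComb β T).rank ≤ n * (n - r) := by
  obtain ⟨S, hS, hlim⟩ := mem_closure_iff_seq_limit.mp (mem_closure_of_degeneratesTo h)
  have hex : ∀ t, ∃ β : Fin a → ℂ, ‖β‖ = 1 ∧ (sliceComb β (S t)).rank ≤ n * (n - r) := by
    intro t
    obtain ⟨A, B, C, hABC⟩ := hS t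
    rw [← hABC]
    exact exists_rank_sliceComb_act_le A B C hr
  choose β hβ hrank using hex
  obtain ⟨γ, hγ, φ, hφ, hβγ⟩ := (isCompact_sphere (0 : Fin a → ℂ) 1).tendsto_subseq
    (x := β) (fun t => by simpa using hβ t)
  refine ⟨γ, fun h0 => by simp [h0] at hγ, ?_⟩
  -- Joint continuity is needed: coefficients and tensors vary together along the subsequence.
  have hcont : Continuous fun p : (Fin a → ℂ) × Tensor3 a b c => sliceComb p.1 p.2 := by
    unfold sliceComb
    refine continuous_matrix fun j k => ?_
    simp only [Matrix.of_apply]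
    fun_prop
  have hten := (hcont.tendsto (γ, T)).comp (hβγ.prodMk_nhds (hlim.comp hφ.tendsto_atTop))
  exact (Matrix.isClosed_setOf_rank_le b c (n * (n - r))).mem_of_tendsto hten
    (Filter.Eventually.of_forall fun t => hrank (φ t))

end Tensor3

/-! ### The minrank bound -/

theorem lemma3p10 (n a b c : ℕ) (T : Tensor3 a b c) (hT : T ≠ 0) (hc : Tensor3.Concise T)
    (hdeg : Tensor3.DegeneratesTo (Tensor3.matMul n n n) T) :
    (Tensor3.minrank T : ℤ) ≤ (n : ℤ) * ((n : ℤ) - ⌊Real.sqrt ((a : ℝ) - 1)⌋) := by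
  have ha : 1 ≤ a := by
    by_contra h
    obtain rfl : a = 0 := by omega
    exact hT (funext fun i => i.elim0)
  have hfloor : ⌊Real.sqrt ((a : ℝ) - 1)⌋ = (Nat.sqrt (a - 1) : ℤ) := by
    have : (a : ℝ) - 1 = ((a - 1 : ℕ) : ℝ) := by
      rw [Nat.cast_sub ha, Nat.cast_one]
    rw [this, Real.floor_real_sqrt_eq_nat_sqrt]
  rw [hfloor]
  set r := Nat.sqrt (a - 1)
  have hr : r ^ 2 < a := by
    have : r ^ 2 ≤ a - 1 := Nat.sqrt_le' (a - 1)
    omega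
  obtain ⟨β, hβ, hrank⟩ := Tensor3.exists_rank_sliceComb_le_of_degeneratesTo hdeg hr
  have hne : (Tensor3.sliceComb β T).rank ≠ 0 := by
    exact fun h0 => hc.sliceComb_ne_zero hβ (Matrix.eq_zero_of_rank_eq_zero h0)
  have hmin : Tensor3.minrank T ≤ n * (n - r) :=
    le_trans (Nat.sInf_le (Set.mem_sdiff_singleton.mpr ⟨⟨β, rfl⟩, hne⟩)) hrank
  -- If `r > n`, truncated subtraction would bound the nonzero rank by zero; so natural and integer
  -- differences agree.
  have hrn : r ≤ n := by
    by_contra hlt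
    rw [Nat.sub_eq_zero_of_le (by omega), mul_zero] at hrank
    omega
  rw [← Nat.cast_sub hrn]
  exact_mod_cast hmin
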